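/- Let $p\neq q$ be prime numbers, $k$ a field of characteristic $p$, and $\Gamma\subset\mathbb Q$ a subgroup containing $\frac1{q^i}$ for all $i\in\mathbb N$. Let $\Gamma^*\supset\Gamma$ be an ordered abelian group, and let $v$ denote the $t$-adic valuation of the field $k((t^{\Gamma^*}))$ of generalized power series (and its restriction to $k((t^\Gamma))\subset k((t^{\Gamma^*}))$). For $i\ge1$ put $\beta_i=1-\frac1{q^i}$, and $$w=\sum_{j=1}^\infty t^{\beta_j},\qquad w_{0l}=\sum_{j=1}^{l}t^{\beta_j},\qquad w_l=\sum_{j=l+1}^\infty t^{\beta_j}\qquad(l\ge1).$$ Let $n\ge0$, let $\gamma_1,\dots,\gamma_n\in\Gamma$ be strictly positive, let $\beta\in\Gamma^*$ with $\beta\ge1$, and let $c\in k$. Let $\mathcal O$ be the valuation ring of the $t$-adic valuation of $k(t^{\gamma_1},\dots,t^{\gamma_n})$ and $\tilde{\mathcal O}$ its henselization, that is, the smallest henselian local ring that contains $\mathcal O$ and is dominated by the valuation ring of $k((t^{\Gamma^*}))$. Let $W$ be an independent variable and let $\tilde{\mathcal O}\langle W\rangle\subset\tilde{\mathcal O}[[W]]$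 be the henselization of $\tilde{\mathcal O}[W]$ at the ideal generated by $W$ and the maximal ideal of $\tilde{\mathcal O}$, that is, the smallest henselian local subring of $\tilde{\mathcal O}[[W]]$ that contains $\tilde{\mathcal O}[W]$ and is dominated by $\tilde{\mathcal O}[[W]]$. For a power series $f=\sum_j a_jW^j$ let $\partial_if=\sum_{j\ge i}\binom ji a_jW^{j-i}$ be its $i$-th Hasse derivative, and let $f(y)=\sum_j a_jy^j$, as a formal sum of generalized power series. Let $f\in\tilde{\mathcal O}\langle W\rangle\setminus\{0\}$. Then the series $f(y)$ and $(\partial_if)(y)$, $i\ge0$, are well defined for every $y\in k((t^{\Gamma^*}))$ with $v(y)>0$, and there exist integers $l_0\ge1$ and $e\ge0$ such that for all integers $l\ge l_0$ the following hold. 1. $v\big(f(w+ct^\beta)\big)=v\big(f(w_{0l})\big)\neq\infty$. 2. The two minima below exist, and $$v\big(f(w_{0l})\big)<\min_{i\ge1}\big\{v(\partial_if(w))+i\,v(w_l)\big\}=\min_{i\ge1}\big\{v(\partial_if(w))+i\beta_{l+1}\big\}.$$ 3. If $f\notin\tilde{\mathcal O}$, then for every $i\ge1$ with $i\ne p^e$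 $$v\big(\partial_{p^e}f(w+ct^\beta)\big)+p^e\beta_{l+1}<v\big(\partial_if(w+ct^\beta)\big)+i\beta_{l+1},$$ and likewise with $w$ in place of $w+ct^\beta$; in particular, the minimum in (2) is attained for $i=p^e$ only. -/

import Mathlib

noncomputable section

namespace QuasiFinite

/-! ### Henselization -/

/-- The henselization of a subring `A` of a ring `S` (in the applications `S` is a henselian local
ring containing the henselization of `A`), realised inside `S`: the smallest henselian local subring
of `S` which contains `A` and is dominated by `S`. The base point of `Spec A` at which one
henselizes is the contraction of the maximal ideal of `S`. -/
def henselization {S : Type*} [CommRing S] (A : Subring S) : Subring S :=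
  sInf {R : Subring S | A ≤ R ∧ HenselianLocalRing R ∧ IsLocalHom R.subtype}

/-! ### Hahn series -/

section Hahn

variable {k G : Type*} [Field k] [AddCommGroup G] [LinearOrder G] [IsOrderedAddMonoid G]

/-- The valuation ring of the `t`-adic valuation `v = HahnSeries.orderTop` of `k((t^G))`. -/
def hahnValuationRing (k G : Type*) [Field k] [AddCommGroup G] [LinearOrder G]
    [IsOrderedAddMonoid G] : Subring (HahnSeries G k) where
  carrier := {x | 0 ≤ x.orderTop}
  mul_mem' {x y} hx hy := by
    have h := HahnSeries.orderTop_add_le_mul (x := x) (y := y)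
    exact le_trans (add_nonneg hx hy) h
  one_mem' := by simp
  add_mem' {x y} hx hy := by
    have h := HahnSeries.min_orderTop_le_orderTop_add (x := x) (y := y)
    exact le_trans (le_min hx hy) h
  zero_mem' := by simp
  neg_mem' {x} hx := by simpa using hx

/-- The valuation ring of the `t`-adic valuation on `k(t^{g_1}, …, t^{g_n})`, as a subring of
the valuation ring of `k((t^G))`. -/
def baseRing (k : Type*) {G : Type*} [Field k] [AddCommGroup G] [LinearOrder G]
    [IsOrderedAddMonoid G] {n : ℕ} (g : Fin n → G) : Subring (hahnValuationRing k G) :=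
  (IntermediateField.adjoin k
    (Set.range fun j => (HahnSeries.single (g j) 1 : HahnSeries G k))).toSubring.comap
      (hahnValuationRing k G).subtype

/-- The henselization of the valuation ring of `k(t^{g_1}, …, t^{g_n})`. -/
abbrev henselBase (k : Type*) {G : Type*} [Field k] [AddCommGroup G] [LinearOrder G]
    [IsOrderedAddMonoid G] {n : ℕ} (g : Fin n → G) : Subring (hahnValuationRing k G) :=
  henselization (baseRing k g)

/-- The inclusion of the henselization in `k((t^G))`. -/
def henselBaseEmb {n : ℕ} (g : Fin n → G) : henselBase k g →+* HahnSeries G k :=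
  (hahnValuationRing k G).subtype.comp (henselBase k g).subtype

/-- The ring `B⟨W⟩`, the henselization of `B[W]` at the ideal generated by `W` and the maximal
ideal of `B`, for a henselian local ring `B`. It is realised inside the ring `B[[W]]`. -/
def henselPowerSeries (B : Type*) [CommRing B] : Subring (PowerSeries B) :=
  henselization (Polynomial.coeToPowerSeries.ringHom (R := B)).range

/-- The `b`-th Hasse derivative `∂_b (∑ a_j W^j) = ∑ (j choose b) a_j W^(j-b)`. -/
def hasseDeriv {R : Type*} [CommRing R] (b : ℕ) (f : PowerSeries R) : PowerSeries R :=
  PowerSeries.mk fun j => ((j + b).choose b : R) * PowerSeries.coeff (j + b) f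

/-- The series `f(x) = ∑ a_j x^j` makes sense as a formal sum of Hahn series: the union of the
supports of the terms is well-ordered, and each exponent occurs in finitely many terms only. -/
def Evaluable (f : PowerSeries (HahnSeries G k)) (x : HahnSeries G k) : Prop :=
  ∃ s : HahnSeries.SummableFamily G k ℕ, ∀ j, s j = PowerSeries.coeff j f * x ^ j

open Classical in
/-- The value `f(x) = ∑ a_j x^j` of a power series `f = ∑ a_j W^j` with coefficients in `k((t^G))`
at an element `x` of `k((t^G))`; junk value `0` if the sum does not make sense. -/
def evalAt (f : PowerSeries (HahnSeries G k)) (x : HahnSeries G k) : HahnSeries G k :=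
  if h : Evaluable f x then h.choose.hsum else 0

end Hahn

/-! ### The series `w`, its truncations `w_{0l}` and its tails `w_l` -/

section Series

variable {q : ℕ} {Γ : AddSubgroup ℚ}

/-- The exponents `β_i = 1 - 1 / q^i`. -/
def betaSeq (hΓ : ∀ i : ℕ, 1 / (q : ℚ) ^ i ∈ Γ) (i : ℕ) : Γ :=
  ⟨1 - 1 / (q : ℚ) ^ i, Γ.sub_mem (by simpa using hΓ 0) (hΓ i)⟩

theorem betaSeq_monotone [Fact q.Prime] (hΓ : ∀ i : ℕ, 1 / (q : ℚ) ^ i ∈ Γ) :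
    Monotone (betaSeq hΓ) := by
  intro i j hij
  have hq : (1 : ℚ) ≤ q := by exact_mod_cast (Fact.out : q.Prime).one_lt.le
  have h : 1 / (q : ℚ) ^ j ≤ 1 / (q : ℚ) ^ i :=
    one_div_le_one_div_of_le (by positivity) (pow_le_pow_right₀ hq hij)
  change (1 : ℚ) - 1 / (q : ℚ) ^ i ≤ 1 - 1 / (q : ℚ) ^ j
  linarith

variable [Fact q.Prime] {G : Type*} [AddCommGroup G] [LinearOrder G] [IsOrderedAddMonoid G]

open Classical in
/-- `w_l = ∑_{j > l} t^{β_j}` in `k((t^G))`, where the group `Γ` of exponents is mapped to `G` by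
`ι`. -/
def wTail (k : Type*) [Field k] (hΓ : ∀ i : ℕ, 1 / (q : ℚ) ^ i ∈ Γ) (ι : Γ →+o G) (l : ℕ) :
    HahnSeries G k where
  coeff g := if ∃ j, l < j ∧ g = ι (betaSeq hΓ j) then 1 else 0
  isPWO_support' := by
    have hm : Monotone fun j => ι (betaSeq hΓ j) := fun i j hij =>
      OrderHomClass.mono ι (betaSeq_monotone hΓ hij)
    refine ((Set.IsPWO.of_linearOrder (Set.univ : Set ℕ)).image_of_monotone hm).mono ?_
    intro g hg
    by_contra hne
    refine hg (if_neg ?_)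
    rintro ⟨j, -, rfl⟩
    exact hne ⟨j, trivial, rfl⟩

/-- `w = ∑_{j ≥ 1} t^{β_j}`. -/
def wSeries (k : Type*) [Field k] (hΓ : ∀ i : ℕ, 1 / (q : ℚ) ^ i ∈ Γ) (ι : Γ →+o G) :
    HahnSeries G k :=
  wTail k hΓ ι 0

/-- `w_{0l} = ∑_{j = 1}^l t^{β_j}`. -/
def wTrunc (k : Type*) [Field k] (hΓ : ∀ i : ℕ, 1 / (q : ℚ) ^ i ∈ Γ) (ι : Γ →+o G) (l : ℕ) :
    HahnSeries G k :=
  ∑ j ∈ Finset.Icc 1 l, HahnSeries.single (ι (betaSeq hΓ j)) 1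

end Series

end QuasiFinite

end

section

open QuasiFinite Finset

/-! ### Evaluation of power series at Hahn series -/

section Evaluation

variable {k G : Type*} [Field k] [AddCommGroup G] [LinearOrder G] [IsOrderedAddMonoid G]

/-! The henselization enters only through a bound on exponents. The `γ j` are multiples of one
positive `δ` in `Γ`, so the base ring lies in `k[[t^δ]]`, which is henselian and dominated by the
valuation ring of the Hahn series field; by minimality so does its henselization. Hence all
coefficients of `f` have exponents in the set `S` of multiples `m • δ`, which is well-ordered,
nonnegative and `q`-adically bounded. Everything else holds for any nonzero power series `F` with
coefficients supported in such a set.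

Write `b i` for the value of the `i`-th Hasse derivative of `F` at `w`. By Taylor's formula the
behaviour of `F` near `w` is governed by the affine functions `b i + i β_{l+1}`. As `l` grows,
exactly one index eventually minimizes them (`exists_eventually_unique_minimizer`).

The heart is `eventually_orderTop_evalAt_lt`: over all `i ≥ 0` the minimizer is `0`. Suppose it is
`i = p^e m` with `p ∤ m`, and let `g` be the Hasse derivative of order `i - p^e`. By Lucas the
`p^e`-th derivative of `g` is a nonzero constant times the `i`-th derivative of `F`, so Taylor
expansion of `g` at `w_{0l} = w - w_l` gives `v(g(w_{0l})) = b i + p^e β_{l+1}`. For large `l` the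
left side has `q`-adic norm at most `q^l`, like all exponents of `w_{0l}` and of the coefficients.
Comparing `l` with `l + 1` forces `q ∣ p^e`, which contradicts `p ≠ q`.

So `F(w) ≠ 0`, and its value is unchanged by perturbations of order at least `β_{l+1}`, such as
`-w_l` and `c t^β`. Over `i ≥ 1`, a minimizer `p^e m` with `m ≠ 1` is impossible: the same result
for the `p^e`-th derivative of `F` shows that index `p^e` already does better
(`exists_pow_eventually_unique_minimizer`). -/

theorem evaluable_of_support_subset {S : Set G} (hS : S.IsPWO) {F : PowerSeries (HahnSeries G k)}
    (hF : ∀ j, (PowerSeries.coeff j F).support ⊆ S) {y : HahnSeries G k} (hy : 0 < y.orderTop) :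
    Evaluable F y := by
  have hP := HahnSeries.SummableFamily.isPWO_iUnion_support_powers (x := y)
    (HahnSeries.zero_le_orderTop_iff.1 hy.le)
  refine ⟨⟨fun j => PowerSeries.coeff j F * y ^ j, (hS.add hP).mono ?_, fun g => ?_⟩,
    fun _ => rfl⟩
  · refine Set.iUnion_subset fun j => HahnSeries.support_mul_subset.trans ?_
    exact Set.add_subset_add (hF j) (Set.subset_iUnion (fun j : ℕ => (y ^ j).support) j)
  -- An exponent `g` splits in finitely many ways as a coefficient exponent plus an exponent of a
  -- power of `y`, and the latter occurs in finitely many powers because `v(y) > 0`.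
  · refine ((Set.AddAntidiagonal.finite_of_isPWO hS hP g).biUnion fun a _ =>
      HahnSeries.SummableFamily.pow_finite_co_support hy a.2).subset fun j hj => ?_
    obtain ⟨a, ha, b, hb, hab⟩ := HahnSeries.support_mul_subset hj
    simp only [Set.mem_iUnion]
    exact ⟨(a, b), ⟨hF j ha, Set.mem_iUnion.2 ⟨j, hb⟩, hab⟩, hb⟩

theorem evalAt_eq_hsum {F : PowerSeries (HahnSeries G k)} {y : HahnSeries G k}
    (s : HahnSeries.SummableFamily G k ℕ) (hs : ∀ j, s j = PowerSeries.coeff j F * y ^ j) :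
    evalAt F y = s.hsum := by
  have h : Evaluable F y := ⟨s, hs⟩
  rw [evalAt, dif_pos h]
  congr 1
  ext1 j
  rw [h.choose_spec, hs]

theorem coeff_evalAt {F : PowerSeries (HahnSeries G k)} {y : HahnSeries G k} (h : Evaluable F y)
    (g : G) : (evalAt F y).coeff g = ∑ᶠ j, (PowerSeries.coeff j F * y ^ j).coeff g := by
  obtain ⟨s, hs⟩ := h
  rw [evalAt_eq_hsum s hs, HahnSeries.SummableFamily.coeff_hsum]
  simp only [hs]

theorem evalAt_zero_left (y : HahnSeries G k) : evalAt 0 y = 0 := by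
  rw [evalAt_eq_hsum 0 (by simp), HahnSeries.SummableFamily.hsum_zero]

theorem evalAt_smul {F : PowerSeries (HahnSeries G k)} {y : HahnSeries G k} (h : Evaluable F y)
    (a : HahnSeries G k) : evalAt (a • F) y = a * evalAt F y := by
  obtain ⟨s, hs⟩ := h
  rw [evalAt_eq_hsum s hs, ← HahnSeries.SummableFamily.hsum_smul]
  exact evalAt_eq_hsum _ fun j => by
    rw [HahnSeries.SummableFamily.smul_apply, hs, HahnSeries.of_symm_smul_of_eq_mul,
      PowerSeries.coeff_smul, smul_eq_mul, mul_assoc]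

theorem orderTop_nsmul_le_evalAt_sub_sum {F : PowerSeries (HahnSeries G k)} {y : HahnSeries G k}
    (h : Evaluable F y) (hF : ∀ j, 0 ≤ (PowerSeries.coeff j F).orderTop) (hy : 0 ≤ y.orderTop)
    (N : ℕ) : N • y.orderTop ≤
      (evalAt F y - ∑ j ∈ range N, PowerSeries.coeff j F * y ^ j).orderTop := by
  rw [HahnSeries.le_orderTop_iff_forall]
  intro g hg
  rw [HahnSeries.coeff_sub, HahnSeries.coeff_sum, coeff_evalAt h, sub_eq_zero]
  refine finsum_eq_sum_of_support_subset _ fun j hj => ?_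
  by_contra hjN
  simp only [coe_range, Set.mem_Iio, not_lt] at hjN
  refine hj (HahnSeries.coeff_eq_zero_of_lt_orderTop (hg.trans_le ?_))
  rw [HahnSeries.orderTop_mul]
  calc N • y.orderTop ≤ j • y.orderTop := nsmul_le_nsmul_left hy hjN
    _ ≤ (y ^ j).orderTop := HahnSeries.orderTop_nsmul_le_orderTop_pow
    _ ≤ _ := le_add_of_nonneg_left (hF j)

theorem orderTop_natCast_nonneg (n : ℕ) : 0 ≤ ((n : HahnSeries G k)).orderTop := by
  rw [← map_natCast (HahnSeries.C : k →+* HahnSeries G k)]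
  exact HahnSeries.orderTop_single_le

theorem orderTop_natCast {n : ℕ} (hn : (n : k) ≠ 0) : ((n : HahnSeries G k)).orderTop = 0 := by
  rw [← map_natCast (HahnSeries.C : k →+* HahnSeries G k)]
  exact HahnSeries.orderTop_single hn

theorem support_natCast_mul_subset (n : ℕ) (a : HahnSeries G k) :
    ((n : HahnSeries G k) * a).support ⊆ a.support := by
  intro g hg hga
  apply hg
  rw [← map_natCast (HahnSeries.C : k →+* HahnSeries G k), HahnSeries.C_mul_eq_smul,
    HahnSeries.coeff_smul, hga, smul_zero]

/-! ### Hasse derivatives and Taylor expansion -/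

theorem hasseDeriv_zero_index {R : Type*} [CommRing R] (f : PowerSeries R) :
    QuasiFinite.hasseDeriv 0 f = f := by
  ext j
  simp [QuasiFinite.hasseDeriv]

theorem hasseDeriv_hasseDeriv {R : Type*} [CommRing R] (i j : ℕ) (f : PowerSeries R) :
    QuasiFinite.hasseDeriv i (QuasiFinite.hasseDeriv j f) =
      ((i + j).choose j : R) • QuasiFinite.hasseDeriv (i + j) f := by
  ext m
  simp only [QuasiFinite.hasseDeriv, PowerSeries.coeff_mk, PowerSeries.coeff_smul, smul_eq_mul]
  rw [← mul_assoc, ← mul_assoc, ← Nat.cast_mul, ← Nat.cast_mul, ← add_assoc]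
  congr 2
  have h := Nat.choose_mul (n := m + i + j) (k := i + j) (s := j) (by omega)
  rw [show m + i + j - j = m + i by omega, show i + j - j = i by omega] at h
  rw [mul_comm ((i + j).choose j), h, mul_comm]

theorem hasseDeriv_map {R R' : Type*} [CommRing R] [CommRing R'] (φ : R →+* R') (i : ℕ)
    (f : PowerSeries R) : (QuasiFinite.hasseDeriv i f).map φ =
      QuasiFinite.hasseDeriv i (f.map φ) := by
  ext j
  simp [QuasiFinite.hasseDeriv]

theorem support_coeff_hasseDeriv_subset {S : Set G} {F : PowerSeries (HahnSeries G k)}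
    (hF : ∀ j, (PowerSeries.coeff j F).support ⊆ S) (i j : ℕ) :
    (PowerSeries.coeff j (QuasiFinite.hasseDeriv i F)).support ⊆ S := by
  rw [QuasiFinite.hasseDeriv, PowerSeries.coeff_mk]
  exact (support_natCast_mul_subset _ _).trans (hF _)

omit [IsOrderedAddMonoid G] in
theorem orderTop_nonneg_of_support_subset {S : Set G} (hS : ∀ g ∈ S, 0 ≤ g) {a : HahnSeries G k}
    (ha : a.support ⊆ S) : 0 ≤ a.orderTop := by
  rw [HahnSeries.le_orderTop_iff_forall]
  intro g hg
  by_contra hne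
  exact absurd (WithTop.coe_le_coe.2 (hS g (ha hne))) (not_le.2 hg)

/-- Taylor's formula for a polynomial: expand binomially and exchange summation over the triangle `i
+ j < N`. -/
theorem sum_mul_add_pow_eq {R : Type*} [CommRing R] (a : ℕ → R) (y z : R) (N : ℕ) :
    ∑ j ∈ range N, a j * (y + z) ^ j = ∑ i ∈ range N,
      (∑ j ∈ range (N - i), ((j + i).choose i : R) * a (j + i) * y ^ j) * z ^ i := by
  have h := sum_range_diag_flip N fun i j => ((j + i).choose i : R) * a (j + i) * y ^ j * z ^ i
  simp only [sum_mul, ← h]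
  refine sum_congr rfl fun j _ => ?_
  rw [add_comm y z, add_pow, mul_sum]
  refine sum_congr rfl fun i hi => ?_
  rw [Nat.sub_add_cancel (by simpa [Nat.lt_succ_iff] using hi)]
  ring

theorem le_orderTop_sum {α : Type*} (s : Finset α) (a : α → HahnSeries G k) {c : WithTop G}
    (h : ∀ i ∈ s, c ≤ (a i).orderTop) : c ≤ (∑ i ∈ s, a i).orderTop := by
  simp only [← HahnSeries.addVal_apply] at h ⊢
  exact AddValuation.map_le_sum _ h

/-- Taylor's formula up to order `N • m`, which avoids infinite double sums. The polynomial
truncations satisfy the formula exactly; cutting the `i`-th derivative after `N - i` terms costs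
order `(N - i) • m`, and `z ^ i` contributes the missing `i • m`. -/
theorem nsmul_le_orderTop_evalAt_add_sub_sum {S : Set G} (hS : S.IsPWO) (hS0 : ∀ g ∈ S, 0 ≤ g)
    {F : PowerSeries (HahnSeries G k)} (hF : ∀ j, (PowerSeries.coeff j F).support ⊆ S)
    {y z : HahnSeries G k} {m : WithTop G} (hm : 0 < m)
    (hy : m ≤ y.orderTop) (hz : m ≤ z.orderTop) (N : ℕ) :
    N • m ≤ (evalAt F (y + z) -
      ∑ i ∈ range N, evalAt (QuasiFinite.hasseDeriv i F) y * z ^ i).orderTop := by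
  have hyz : m ≤ (y + z).orderTop := (le_min hy hz).trans HahnSeries.min_orderTop_le_orderTop_add
  have hD := fun i => support_coeff_hasseDeriv_subset hF i
  have h1 := orderTop_nsmul_le_evalAt_sub_sum
    (evaluable_of_support_subset hS hF (hm.trans_le hyz))
    (fun j => orderTop_nonneg_of_support_subset hS0 (hF j)) (hm.le.trans hyz) N
  have h2 : ∀ i ∈ range N, N • m ≤ ((evalAt (QuasiFinite.hasseDeriv i F) y - ∑ j ∈ range (N - i),
      PowerSeries.coeff j (QuasiFinite.hasseDeriv i F) * y ^ j) * z ^ i).orderTop := by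
    intro i hi
    have h3 := orderTop_nsmul_le_evalAt_sub_sum
      (evaluable_of_support_subset hS (hD i) (hm.trans_le hy))
      (fun j => orderTop_nonneg_of_support_subset hS0 (hD i j)) (hm.le.trans hy) (N - i)
    rw [HahnSeries.orderTop_mul]
    calc N • m = (N - i) • m + i • m := by
          rw [← add_nsmul, Nat.sub_add_cancel (mem_range.1 hi).le]
      _ ≤ _ := add_le_add ((nsmul_le_nsmul_right hy _).trans h3)
          ((nsmul_le_nsmul_right hz _).trans HahnSeries.orderTop_nsmul_le_orderTop_pow)
  have h4 := le_orderTop_sum _ _ h2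
  have h5 := (le_min ((nsmul_le_nsmul_right hyz N).trans h1) h4).trans
    HahnSeries.min_orderTop_le_orderTop_sub
  refine h5.trans_eq (congrArg _ ?_)
  rw [sum_mul_add_pow_eq (fun j => PowerSeries.coeff j F)]
  simp only [sub_mul, sum_sub_distrib, QuasiFinite.hasseDeriv, PowerSeries.coeff_mk]
  ring

/-- A strictly dominant Taylor term determines the value. `hN` places that term below the truncation
error, so only finitely many competitors remain. -/
theorem orderTop_evalAt_add_eq {S : Set G} (hS : S.IsPWO) (hS0 : ∀ g ∈ S, 0 ≤ g)
    {F : PowerSeries (HahnSeries G k)} (hF : ∀ j, (PowerSeries.coeff j F).support ⊆ S)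
    {y z : HahnSeries G k} {m : WithTop G} (hm : 0 < m)
    (hy : m ≤ y.orderTop) (hz : m ≤ z.orderTop) {i : ℕ} {N : ℕ}
    (hN : (evalAt (QuasiFinite.hasseDeriv i F) y).orderTop + i • z.orderTop < N • m)
    (hi : ∀ j ≠ i, (evalAt (QuasiFinite.hasseDeriv i F) y).orderTop + i • z.orderTop <
      (evalAt (QuasiFinite.hasseDeriv j F) y).orderTop + j • z.orderTop) :
    (evalAt F (y + z)).orderTop =
      (evalAt (QuasiFinite.hasseDeriv i F) y).orderTop + i • z.orderTop := by
  have hpow : ∀ j, (z ^ j).orderTop = j • z.orderTop := fun j => by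
    simp only [← HahnSeries.addVal_apply, AddValuation.map_pow]
  have hlead : (evalAt (QuasiFinite.hasseDeriv i F) y * z ^ i).orderTop =
      (evalAt (QuasiFinite.hasseDeriv i F) y).orderTop + i • z.orderTop := by
    rw [HahnSeries.orderTop_mul, hpow]
  have hne : (evalAt (QuasiFinite.hasseDeriv i F) y).orderTop + i • z.orderTop ≠ ⊤ :=
    ne_top_of_lt hN
  have hT : (evalAt (QuasiFinite.hasseDeriv i F) y).orderTop + i • z.orderTop <
      (evalAt F (y + z) - ∑ j ∈ range (N + i + 1),
        evalAt (QuasiFinite.hasseDeriv j F) y * z ^ j).orderTop :=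
    hN.trans_le ((nsmul_le_nsmul_left hm.le (by omega)).trans
      (nsmul_le_orderTop_evalAt_add_sub_sum hS hS0 hF hm hy hz (N + i + 1)))
  have hR : (evalAt (QuasiFinite.hasseDeriv i F) y).orderTop + i • z.orderTop <
      (∑ j ∈ (range (N + i + 1)).erase i,
        evalAt (QuasiFinite.hasseDeriv j F) y * z ^ j).orderTop := by
    simp only [← HahnSeries.addVal_apply] at hne hi ⊢
    refine AddValuation.map_lt_sum _ hne fun j hj => ?_
    rw [AddValuation.map_mul, AddValuation.map_pow]
    exact hi j (ne_of_mem_erase hj)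
  rw [← hlead] at hT hR ⊢
  have hsum := lt_of_lt_of_le (lt_min hT hR) HahnSeries.min_orderTop_le_orderTop_add
  rw [← HahnSeries.orderTop_add_eq_left hsum]
  congr 1
  rw [← add_sum_erase (range (N + i + 1)) _ (mem_range.2 (show i < N + i + 1 by omega))]
  ring

theorem support_evalAt_subset {S : Set G} (hS : S.IsPWO)
    {F : PowerSeries (HahnSeries G k)} (hF : ∀ j, (PowerSeries.coeff j F).support ⊆ S)
    {T : AddSubgroup G} (hST : S ⊆ T) {y : HahnSeries G k}
    (hy : 0 < y.orderTop) (hyT : y.support ⊆ T) : (evalAt F y).support ⊆ T := by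
  have hpow : ∀ j : ℕ, (y ^ j).support ⊆ T := by
    intro j
    induction j with
    | zero =>
      intro g hg
      rw [pow_zero, HahnSeries.support_one, Set.mem_singleton_iff] at hg
      exact hg ▸ T.zero_mem
    | succ j ih =>
      rw [pow_succ]
      intro g hg
      obtain ⟨a, ha, b, hb, rfl⟩ := HahnSeries.support_mul_subset hg
      exact T.add_mem (ih ha) (hyT hb)
  intro g hg
  rw [HahnSeries.mem_support, coeff_evalAt (evaluable_of_support_subset hS hF hy)] at hg
  obtain ⟨j, hj⟩ : ∃ j, (PowerSeries.coeff j F * y ^ j).coeff g ≠ 0 := by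
    by_contra! h
    exact hg (by simp [h])
  obtain ⟨a, ha, b, hb, rfl⟩ := HahnSeries.support_mul_subset hj
  exact T.add_mem (hST (hF j ha)) (hpow j hb)

end Evaluation

/-! ### Eventual minimizers of families of affine functions -/

section Minimizer

variable {G : Type*} [AddCommGroup G] [LinearOrder G] [IsOrderedAddMonoid G]

/-- The line of larger slope gains strictly: once it is not below the other, it stays strictly
above. -/
theorem eventually_affine_lt_or_lt {β : ℕ → G} (hβ : StrictMono β) (x y : G) {i j : ℕ}
    (hij : i < j) : (∀ᶠ l in Filter.atTop, x + i • β l < y + j • β l) ∨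
      ∀ᶠ l in Filter.atTop, y + j • β l < x + i • β l := by
  by_cases h : ∃ l, x + i • β l ≤ y + j • β l
  · obtain ⟨l₀, h₀⟩ := h
    refine Or.inl ((Filter.eventually_gt_atTop l₀).mono fun l hl => ?_)
    have h1 : i • (β l - β l₀) < j • (β l - β l₀) :=
      nsmul_lt_nsmul_left (sub_pos.2 (hβ hl)) hij
    have h2 := add_lt_add_of_le_of_lt h₀ h1
    simpa only [nsmul_sub, add_assoc, add_sub_cancel] using h2
  · push Not at h
    exact Or.inr (Filter.Eventually.of_forall h)

/-- Indices `j ≥ N` never compete, since their values are at least `N • β 0`, while the value at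
`i₀` stays below that bound. Among the finitely many others each pair is eventually strictly
ordered. -/
theorem exists_eventually_unique_minimizer {b : ℕ → WithTop G} (hb : ∀ i, 0 ≤ b i) {β : ℕ → G}
    (hβ : StrictMono β) (h0 : 0 < β 0) {B : G} (hB : ∀ l, β l ≤ B) {I : Set ℕ} {i₀ N : ℕ}
    (hi₀ : i₀ ∈ I) (hN : b i₀ + ((i₀ • B : G) : WithTop G) < ((N • β 0 : G) : WithTop G)) :
    ∃ i ∈ I, ∃ L, ∀ l, L ≤ l → ∀ j ∈ I, j ≠ i →
      b i + ((i • β l : G) : WithTop G) < b j + ((j • β l : G) : WithTop G) := by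
  classical
  set t : ℕ → ℕ → WithTop G := fun j l => b j + ((j • β l : G) : WithTop G) with ht
  have hβ0 : ∀ l, β 0 ≤ β l := fun l => hβ.monotone (Nat.zero_le l)
  have htB : ∀ l, t i₀ l < ((N • β 0 : G) : WithTop G) := fun l => lt_of_le_of_lt
    (add_le_add_right (WithTop.coe_le_coe.2 (nsmul_le_nsmul_right (hB l) _)) _) hN
  have hlow : ∀ j l, ((j • β 0 : G) : WithTop G) ≤ t j l := fun j l =>
    le_trans (WithTop.coe_le_coe.2 (nsmul_le_nsmul_right (hβ0 l) _)) (le_add_of_nonneg_left (hb j))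
  have hpair : ∀ i j, i ≠ j → b i ≠ ⊤ → b j ≠ ⊤ → (∀ᶠ l in Filter.atTop, t i l < t j l) ∨
      ∀ᶠ l in Filter.atTop, t j l < t i l := by
    intro i j hij hi hj
    obtain ⟨x, hx⟩ := WithTop.ne_top_iff_exists.1 hi
    obtain ⟨y, hy⟩ := WithTop.ne_top_iff_exists.1 hj
    simp only [ht, ← hx, ← hy, ← WithTop.coe_add, WithTop.coe_lt_coe]
    rcases hij.lt_or_gt with h | h
    · exact eventually_affine_lt_or_lt hβ x y h
    · exact (eventually_affine_lt_or_lt hβ y x h).symm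
  set J : Finset ℕ := (range N).filter fun i => i ∈ I ∧ b i ≠ ⊤ with hJ
  have hmem : ∀ i, i ∈ J ↔ i < N ∧ i ∈ I ∧ b i ≠ ⊤ := fun i => by simp [hJ]
  have hi₀J : i₀ ∈ J := by
    refine (hmem i₀).2 ⟨?_, hi₀, ?_⟩
    · by_contra h
      exact absurd ((htB 0).trans_le (WithTop.coe_le_coe.2
        (nsmul_le_nsmul_left h0.le (not_lt.1 h)))) (not_lt.2 (hlow i₀ 0))
    · intro h
      simp [h] at hN
  -- Finitely many pairs, so a single `L` witnesses all the eventual inequalities; a minimizer at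
  -- `L` then remains one.
  have hev : ∀ᶠ L in Filter.atTop, ∀ l, L ≤ l → ∀ i ∈ J, ∀ j ∈ J,
      (∀ᶠ l in Filter.atTop, t i l < t j l) → t i l < t j l := by
    rw [Filter.eventually_forall_ge_atTop, Filter.eventually_all_finset]
    intro i _
    rw [Filter.eventually_all_finset]
    intro j _
    by_cases h : ∀ᶠ l in Filter.atTop, t i l < t j l
    · exact h.mono fun l hl _ => hl
    · exact Filter.Eventually.of_forall fun l h' => absurd h' h
  obtain ⟨L, hL⟩ := hev.exists
  obtain ⟨i, hiJ, hi⟩ := J.exists_min_image (fun j => t j L) ⟨i₀, hi₀J⟩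
  have hmin : ∀ l, L ≤ l → ∀ j ∈ J, j ≠ i → t i l < t j l := by
    intro l hl j hj hji
    rcases hpair i j hji.symm ((hmem i).1 hiJ).2.2 ((hmem j).1 hj).2.2 with h | h
    · exact hL l hl i hiJ j hj h
    · exact absurd (hL L le_rfl j hj i hiJ h) (not_lt.2 (hi j hj))
  have hle : ∀ l, L ≤ l → t i l < ((N • β 0 : G) : WithTop G) := by
    intro l hl
    rcases eq_or_ne i₀ i with rfl | h
    · exact htB l
    · exact (hmin l hl i₀ hi₀J h).trans (htB l)
  refine ⟨i, ((hmem i).1 hiJ).2.1, L, fun l hl j hjI hji => ?_⟩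
  by_cases hjJ : j ∈ J
  · exact hmin l hl j hjJ hji
  · refine (hle l hl).trans_le ?_
    by_cases hjN : j < N
    · have : b j = ⊤ := by
        by_contra h
        exact hjJ ((hmem j).2 ⟨hjN, hjI, h⟩)
      rw [this, top_add]
      exact le_top
    · exact (WithTop.coe_le_coe.2 (nsmul_le_nsmul_left h0.le (not_lt.1 hjN))).trans (hlow j l)

end Minimizer

/-! ### The series `w` and its truncations -/

section WSeries

/-- Lucas' theorem, stripping one zero digit in base `p` at a time. -/
theorem not_dvd_choose_pow_mul {p m : ℕ} [Fact p.Prime] (hm : ¬ p ∣ m) (e : ℕ) :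
    ¬ p ∣ (p ^ e * m).choose (p ^ e) := by
  induction e with
  | zero => simpa using hm
  | succ e ih =>
    have hp : 0 < p := (Fact.out : p.Prime).pos
    have h := Choose.choose_modEq_choose_mod_mul_choose_div_nat (p := p) (n := p ^ (e + 1) * m)
      (k := p ^ (e + 1))
    rw [pow_succ', mul_assoc, Nat.mul_mod_right, Nat.mul_mod_right, Nat.mul_div_cancel_left _ hp,
      Nat.mul_div_cancel_left _ hp, Nat.choose_self, one_mul] at h
    rw [pow_succ', mul_assoc, (Nat.ModEq.dvd_iff h dvd_rfl)]
    exact ih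

/-- The elements of `Γ` whose `q`-adic norm is at most `q ^ l`. -/
def padicBall (q : ℕ) [Fact q.Prime] (Γ : AddSubgroup ℚ) (l : ℕ) : AddSubgroup Γ where
  carrier := {x | padicNorm q (x : ℚ) ≤ (q : ℚ) ^ l}
  add_mem' {x y} hx hy := (padicNorm.nonarchimedean).trans (max_le hx hy)
  zero_mem' := by simp
  neg_mem' {x} hx := by simpa using hx

variable {q : ℕ} [Fact q.Prime] {Γ : AddSubgroup ℚ}

theorem padicBall_mono {l l' : ℕ} (h : l ≤ l') : padicBall q Γ l ≤ padicBall q Γ l' := by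
  intro x hx
  have hq : (1 : ℚ) ≤ q := by exact_mod_cast (Fact.out : q.Prime).one_lt.le
  exact le_trans (show padicNorm q (x : ℚ) ≤ (q : ℚ) ^ l from hx) (pow_le_pow_right₀ hq h)

theorem exists_mem_padicBall (x : Γ) : ∃ l, x ∈ padicBall q Γ l := by
  have hq : (1 : ℚ) < q := by exact_mod_cast (Fact.out : q.Prime).one_lt
  obtain ⟨l, hl⟩ := pow_unbounded_of_one_lt (padicNorm q (x : ℚ)) hq
  exact ⟨l, hl.le⟩

theorem padicNorm_one_div_pow (l : ℕ) : padicNorm q (1 / (q : ℚ) ^ l) = (q : ℚ) ^ l := by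
  have : padicNorm q ((q : ℚ) ^ l) = ((q : ℚ) ^ l)⁻¹ := by
    induction l with
    | zero => simp
    | succ l ih => rw [pow_succ, padicNorm.mul, ih, padicNorm.padicNorm_p_of_prime, mul_inv]
  rw [padicNorm.div, padicNorm.one, this, one_div, inv_inv]

theorem betaSeq_mem_padicBall (hΓ : ∀ i : ℕ, 1 / (q : ℚ) ^ i ∈ Γ) (l : ℕ) :
    betaSeq hΓ l ∈ padicBall q Γ l := by
  have hq : (1 : ℚ) ≤ q := by exact_mod_cast (Fact.out : q.Prime).one_lt.le
  have h1 : (⟨1 / (q : ℚ) ^ 0, hΓ 0⟩ : Γ) ∈ padicBall q Γ l :=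
    padicBall_mono (Nat.zero_le l) (padicNorm_one_div_pow (q := q) 0).le
  have h2 : (⟨1 / (q : ℚ) ^ l, hΓ l⟩ : Γ) ∈ padicBall q Γ l := (padicNorm_one_div_pow (q := q) l).le
  have h3 := (padicBall q Γ l).sub_mem h1 h2
  convert h3 using 1
  ext
  simp [betaSeq]

/-- The fractional contribution `r / q^(l+1)` has norm exactly `q^(l+1)` when `q ∤ r`, and
subtracting it from the integer `r` cannot hide this. -/
theorem nsmul_betaSeq_sub_notMem_padicBall (hΓ : ∀ i : ℕ, 1 / (q : ℚ) ^ i ∈ Γ) (l : ℕ) {r : ℕ}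
    (hr : ¬ q ∣ r) : r • betaSeq hΓ (l + 1) ∉ padicBall q Γ l := by
  intro h
  have hq : (1 : ℚ) < q := by exact_mod_cast (Fact.out : q.Prime).one_lt
  have h1 : (⟨1 / (q : ℚ) ^ 0, hΓ 0⟩ : Γ) ∈ padicBall q Γ l :=
    padicBall_mono (Nat.zero_le l) (padicNorm_one_div_pow (q := q) 0).le
  have h2 := (padicBall q Γ l).sub_mem ((padicBall q Γ l).nsmul_mem h1 r) h
  have h3 : padicNorm q (r * (1 / (q : ℚ) ^ (l + 1))) ≤ (q : ℚ) ^ l := by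
    refine le_of_eq_of_le (congrArg _ ?_) h2
    simp [betaSeq]
    ring
  rw [padicNorm.mul, padicNorm_one_div_pow, (padicNorm.nat_eq_one_iff r).2 hr, one_mul] at h3
  exact absurd h3 (not_le.2 (pow_lt_pow_right₀ hq (Nat.lt_succ_self l)))

theorem betaSeq_strictMono (hΓ : ∀ i : ℕ, 1 / (q : ℚ) ^ i ∈ Γ) : StrictMono (betaSeq hΓ) := by
  intro i j hij
  have hq : (1 : ℚ) < q := by exact_mod_cast (Fact.out : q.Prime).one_lt
  have h : 1 / (q : ℚ) ^ j < 1 / (q : ℚ) ^ i :=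
    one_div_lt_one_div_of_lt (by positivity) (pow_lt_pow_right₀ hq hij)
  change (1 : ℚ) - 1 / (q : ℚ) ^ i < 1 - 1 / (q : ℚ) ^ j
  linarith

omit [Fact q.Prime] in
theorem betaSeq_zero (hΓ : ∀ i : ℕ, 1 / (q : ℚ) ^ i ∈ Γ) : betaSeq hΓ 0 = 0 := by
  ext
  simp [betaSeq]

omit [Fact q.Prime] in
theorem betaSeq_le_one (hΓ : ∀ i : ℕ, 1 / (q : ℚ) ^ i ∈ Γ) (h1 : (1 : ℚ) ∈ Γ) (l : ℕ) :
    betaSeq hΓ l ≤ ⟨1, h1⟩ := by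
  change (1 : ℚ) - 1 / (q : ℚ) ^ l ≤ 1
  have : (0 : ℚ) ≤ 1 / (q : ℚ) ^ l := by positivity
  linarith

variable {k G : Type*} [Field k] [AddCommGroup G] [LinearOrder G] [IsOrderedAddMonoid G]
  (hΓ : ∀ i : ℕ, 1 / (q : ℚ) ^ i ∈ Γ) {ι : Γ →+o G}

omit [IsOrderedAddMonoid G] in
theorem orderHom_strictMono (hι : Function.Injective ι) : StrictMono ι :=
  (OrderHomClass.monotone ι).strictMono_of_injective hι

omit [IsOrderedAddMonoid G] in
theorem betaSeq_succ_strictMono (hι : Function.Injective ι) :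
    StrictMono fun l => ι (betaSeq hΓ (l + 1)) :=
  fun _ _ h => orderHom_strictMono hι (betaSeq_strictMono hΓ (Nat.succ_lt_succ h))

omit [IsOrderedAddMonoid G] in
theorem betaSeq_one_pos (hι : Function.Injective ι) : 0 < ι (betaSeq hΓ 1) := by
  rw [← map_zero ι, ← betaSeq_zero hΓ]
  exact orderHom_strictMono hι (betaSeq_strictMono hΓ Nat.zero_lt_one)

omit [IsOrderedAddMonoid G] in
theorem orderTop_wTail (l : ℕ) :
    (wTail k hΓ ι l).orderTop = ((ι (betaSeq hΓ (l + 1)) : G) : WithTop G) := by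
  refine HahnSeries.orderTop_eq_of_le (g := ι (betaSeq hΓ (l + 1))) ?_ ?_
  · rw [HahnSeries.mem_support]
    simp only [wTail]
    rw [if_pos ⟨l + 1, Nat.lt_succ_self l, rfl⟩]
    exact one_ne_zero
  · intro g hg
    rw [HahnSeries.mem_support] at hg
    simp only [wTail, ne_eq, ite_eq_right_iff, not_forall] at hg
    obtain ⟨⟨j, hj, rfl⟩, -⟩ := hg
    exact OrderHomClass.mono ι (betaSeq_monotone hΓ hj)

omit [IsOrderedAddMonoid G] in
theorem wTrunc_add_wTail (hι : Function.Injective ι) (l : ℕ) :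
    wTrunc k hΓ ι l + wTail k hΓ ι l = wSeries k hΓ ι := by
  induction l with
  | zero => simp [wTrunc, wSeries]
  | succ l ih =>
    rw [← ih, wTrunc, wTrunc, sum_Icc_succ_top (by omega), add_assoc]
    congr 1
    have hinj : ∀ {i j}, ι (betaSeq hΓ i) = ι (betaSeq hΓ j) → i = j := fun h =>
      (betaSeq_strictMono hΓ).injective (hι h)
    ext g
    simp only [HahnSeries.coeff_add, wTail, HahnSeries.coeff_single]
    by_cases hg : g = ι (betaSeq hΓ (l + 1))
    · subst hg
      rw [if_pos rfl, if_neg, if_pos ⟨l + 1, Nat.lt_succ_self l, rfl⟩, add_zero]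
      rintro ⟨j, hj, h⟩
      exact absurd (hinj h) (by omega)
    · rw [if_neg hg, zero_add]
      congr 1
      refine propext ⟨fun ⟨j, hj, h⟩ => ⟨j, by omega, h⟩, fun ⟨j, hj, h⟩ => ⟨j, ?_, h⟩⟩
      rcases (Nat.succ_le_of_lt hj).lt_or_eq with h' | rfl
      · exact h'
      · exact absurd h hg

omit [IsOrderedAddMonoid G] in
theorem support_wTrunc_subset (l : ℕ) :
    (wTrunc k hΓ ι l).support ⊆ (padicBall q Γ l).map (ι : Γ →+ G) := by
  intro g hg
  rw [HahnSeries.mem_support, wTrunc, HahnSeries.coeff_sum] at hg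
  obtain ⟨j, hj, h⟩ := exists_ne_zero_of_sum_ne_zero hg
  rw [HahnSeries.coeff_single] at h
  have hgj : g = ι (betaSeq hΓ j) := by
    by_contra h'
    exact h (if_neg h')
  exact ⟨betaSeq hΓ j, padicBall_mono (mem_Icc.1 hj).2 (betaSeq_mem_padicBall hΓ j), hgj.symm⟩

omit [IsOrderedAddMonoid G] in
theorem support_wSeries_subset :
    (wSeries k hΓ ι).support ⊆ (ι : Γ →+ G).range := by
  intro g hg
  rw [HahnSeries.mem_support] at hg
  simp only [wSeries, wTail, ne_eq, ite_eq_right_iff, not_forall] at hg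
  obtain ⟨⟨j, -, rfl⟩, -⟩ := hg
  exact ⟨_, rfl⟩

-- `G` need not be archimedean, but the order of `x` comes from `Γ ⊆ ℚ`, where multiples of `β_1`
-- are unbounded.
omit [IsOrderedAddMonoid G] in
theorem exists_orderTop_add_lt_nsmul (hι : Function.Injective ι) {x : HahnSeries G k} (hx : x ≠ 0)
    (hxs : x.support ⊆ (ι : Γ →+ G).range) (r : Γ) :
    ∃ N : ℕ, x.orderTop + ((ι r : G) : WithTop G) < ((N • ι (betaSeq hΓ 1) : G) : WithTop G) := by
  obtain ⟨g, hg⟩ := WithTop.ne_top_iff_exists.1 (HahnSeries.orderTop_ne_top.2 hx)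
  obtain ⟨a, rfl⟩ := hxs (HahnSeries.coeff_orderTop_ne hg.symm)
  have hpos : (0 : ℚ) < (betaSeq hΓ 1 : ℚ) := by
    have := betaSeq_strictMono hΓ Nat.zero_lt_one
    rw [betaSeq_zero] at this
    exact this
  obtain ⟨N, hN⟩ := exists_lt_nsmul hpos ((a : ℚ) + r)
  refine ⟨N, ?_⟩
  rw [← hg, ← WithTop.coe_add, WithTop.coe_lt_coe, ← map_nsmul]
  change ι a + ι r < _
  rw [← map_add]
  exact orderHom_strictMono hι (show ((a + r : Γ) : ℚ) < ((N • betaSeq hΓ 1 : Γ) : ℚ) by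
    simpa using hN)

end WSeries

/-! ### Values of power series at `w` -/

section Values

variable {q : ℕ} [Fact q.Prime] {Γ : AddSubgroup ℚ}
  {k G : Type*} [Field k] [AddCommGroup G] [LinearOrder G] [IsOrderedAddMonoid G]
  (hΓ : ∀ i : ℕ, 1 / (q : ℚ) ^ i ∈ Γ) {ι : Γ →+o G} (hι : Function.Injective ι)
  {S : Set G} (hS : S.IsPWO) (hS0 : ∀ g ∈ S, 0 ≤ g)
  (hSq : ∃ r, S ⊆ (padicBall q Γ r).map (ι : Γ →+ G))

theorem evalAt_zero_right {S : Set G} (hS : S.IsPWO) (hS0 : ∀ g ∈ S, 0 ≤ g)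
    {F : PowerSeries (HahnSeries G k)} (hF : ∀ j, (PowerSeries.coeff j F).support ⊆ S) :
    evalAt F 0 = PowerSeries.coeff 0 F := by
  have h := orderTop_nsmul_le_evalAt_sub_sum
    (evaluable_of_support_subset (y := 0) hS hF (by simp))
    (fun j => orderTop_nonneg_of_support_subset hS0 (hF j)) (by simp) 1
  rw [one_nsmul, HahnSeries.orderTop_zero, top_le_iff, HahnSeries.orderTop_eq_top, sub_eq_zero] at h
  simpa using h

theorem orderTop_evalAt_hasseDeriv_hasseDeriv {S : Set G} (hS : S.IsPWO)
    {F : PowerSeries (HahnSeries G k)} (hF : ∀ j, (PowerSeries.coeff j F).support ⊆ S)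
    {y : HahnSeries G k} (hy : 0 < y.orderTop) (i j : ℕ) :
    (evalAt (QuasiFinite.hasseDeriv i (QuasiFinite.hasseDeriv j F)) y).orderTop =
      (((i + j).choose j : ℕ) : HahnSeries G k).orderTop +
        (evalAt (QuasiFinite.hasseDeriv (i + j) F) y).orderTop := by
  rw [hasseDeriv_hasseDeriv, evalAt_smul (evaluable_of_support_subset hS
    (support_coeff_hasseDeriv_subset hF (i + j)) hy), HahnSeries.orderTop_mul]

omit [IsOrderedAddMonoid G] in
theorem orderTop_wSeries : (wSeries k hΓ ι).orderTop = ((ι (betaSeq hΓ 1) : G) : WithTop G) :=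
  orderTop_wTail hΓ 0

omit [Fact q.Prime] [IsOrderedAddMonoid G] in
theorem betaSeq_succ_le_one (l : ℕ) :
    ι (betaSeq hΓ (l + 1)) ≤ ι ⟨1, by simpa using hΓ 0⟩ :=
  OrderHomClass.mono ι (betaSeq_le_one hΓ _ _)

include hι

omit [IsOrderedAddMonoid G] in
theorem orderTop_wSeries_pos : 0 < (wSeries k hΓ ι).orderTop := by
  rw [orderTop_wSeries]
  exact WithTop.coe_lt_coe.2 (betaSeq_one_pos hΓ hι)

include hS hSq

theorem exists_orderTop_evalAt_lt {F : PowerSeries (HahnSeries G k)}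
    (hF : ∀ j, (PowerSeries.coeff j F).support ⊆ S)
    (hne : evalAt F (wSeries k hΓ ι) ≠ 0) (i : ℕ) :
    ∃ N : ℕ, (evalAt F (wSeries k hΓ ι)).orderTop +
      ((i • ι ⟨1, by simpa using hΓ 0⟩ : G) : WithTop G) <
        ((N • ι (betaSeq hΓ 1) : G) : WithTop G) := by
  obtain ⟨r, hr⟩ := hSq
  have h := exists_orderTop_add_lt_nsmul hΓ hι hne (support_evalAt_subset hS hF
    (T := (ι : Γ →+ G).range) (hr.trans fun g hg => ?_) (orderTop_wSeries_pos hΓ hι)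
      (support_wSeries_subset hΓ)) (i • ⟨1, by simpa using hΓ 0⟩)
  · simpa only [map_nsmul] using h
  · obtain ⟨a, -, rfl⟩ := hg
    exact ⟨a, rfl⟩

include hS0

/-- If all derivatives vanished at `w`, Taylor expansion from `w` back to `0` would make every
coefficient of `F` vanish to arbitrarily high order. -/
theorem exists_evalAt_hasseDeriv_ne_zero {F : PowerSeries (HahnSeries G k)}
    (hF : ∀ j, (PowerSeries.coeff j F).support ⊆ S) (hF0 : F ≠ 0) :
    ∃ i, evalAt (QuasiFinite.hasseDeriv i F) (wSeries k hΓ ι) ≠ 0 := by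
  by_contra! h
  refine hF0 (PowerSeries.ext fun j => ?_)
  rw [map_zero]
  by_contra hj
  have hDF := support_coeff_hasseDeriv_subset hF j
  obtain ⟨r, hr⟩ := hSq
  obtain ⟨N, hN⟩ := exists_orderTop_add_lt_nsmul hΓ hι hj (((hF j).trans hr).trans fun g hg => by
    obtain ⟨a, -, rfl⟩ := hg
    exact ⟨a, rfl⟩) 0
  have hw := orderTop_wSeries (k := k) (ι := ι) hΓ
  have hT := nsmul_le_orderTop_evalAt_add_sub_sum hS hS0 hDF (orderTop_wSeries_pos hΓ hι) le_rfl
    (z := -wSeries k hΓ ι) (by rw [HahnSeries.orderTop_neg]) N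
  rw [add_neg_cancel, evalAt_zero_right hS hS0 hDF, sum_eq_zero, sub_zero, hw] at hT
  · have hc : PowerSeries.coeff 0 (QuasiFinite.hasseDeriv j F) = PowerSeries.coeff j F := by
      simp [QuasiFinite.hasseDeriv]
    rw [hc] at hT
    simp only [map_zero, WithTop.coe_zero, add_zero] at hN
    exact absurd hN (not_lt.2 hT)
  · intro i _
    have h1 := orderTop_evalAt_hasseDeriv_hasseDeriv hS hF
      (orderTop_wSeries_pos (k := k) hΓ hι) i j
    rw [h (i + j), HahnSeries.orderTop_zero, add_top, HahnSeries.orderTop_eq_top] at h1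
    rw [h1, zero_mul]

theorem exists_eventually_unique_minimizer_evalAt {F : PowerSeries (HahnSeries G k)}
    (hF : ∀ j, (PowerSeries.coeff j F).support ⊆ S) {I : Set ℕ}
    (hI : ∃ i ∈ I, evalAt (QuasiFinite.hasseDeriv i F) (wSeries k hΓ ι) ≠ 0) :
    ∃ i ∈ I, ∃ L, ∀ l, L ≤ l → ∀ j ∈ I, j ≠ i →
      (evalAt (QuasiFinite.hasseDeriv i F) (wSeries k hΓ ι)).orderTop +
          ((i • ι (betaSeq hΓ (l + 1)) : G) : WithTop G) <
        (evalAt (QuasiFinite.hasseDeriv j F) (wSeries k hΓ ι)).orderTop +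
          ((j • ι (betaSeq hΓ (l + 1)) : G) : WithTop G) := by
  obtain ⟨i₀, hi₀, hne⟩ := hI
  obtain ⟨N, hN⟩ := exists_orderTop_evalAt_lt hΓ hι hS hSq
    (support_coeff_hasseDeriv_subset hF i₀) hne i₀
  refine exists_eventually_unique_minimizer (fun i => ?_) (betaSeq_succ_strictMono hΓ hι)
    (betaSeq_one_pos hΓ hι) (betaSeq_succ_le_one hΓ) hi₀ hN
  -- With `z = 0` and no Taylor terms, the estimate just says that the value is nonnegative.
  have h := nsmul_le_orderTop_evalAt_add_sub_sum hS hS0 (support_coeff_hasseDeriv_subset hF i)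
    (orderTop_wSeries_pos (k := k) hΓ hι) le_rfl (z := 0) (by simp) 0
  simpa using h

variable {p : ℕ} [Fact p.Prime] [CharP k p] (hpq : p ≠ q)

include hpq

theorem eventually_orderTop_evalAt_lt {F : PowerSeries (HahnSeries G k)}
    (hF : ∀ j, (PowerSeries.coeff j F).support ⊆ S) (hF0 : F ≠ 0) :
    ∃ L, ∀ l, L ≤ l → ∀ j ≠ 0, (evalAt F (wSeries k hΓ ι)).orderTop <
      (evalAt (QuasiFinite.hasseDeriv j F) (wSeries k hΓ ι)).orderTop +
        ((j • ι (betaSeq hΓ (l + 1)) : G) : WithTop G) := by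
  have hw0 := orderTop_wSeries_pos (k := k) hΓ hι
  obtain ⟨i₀, hi₀⟩ := exists_evalAt_hasseDeriv_ne_zero hΓ hι hS hS0 hSq hF hF0
  obtain ⟨i, -, L, hL⟩ := exists_eventually_unique_minimizer_evalAt hΓ hι hS hS0 hSq hF
    (I := Set.univ) ⟨i₀, trivial, hi₀⟩
  rcases eq_or_ne i 0 with rfl | hi
  · refine ⟨L, fun l hl j hj => ?_⟩
    have h := hL l hl j trivial hj
    rwa [hasseDeriv_zero_index, zero_nsmul, WithTop.coe_zero, add_zero] at h
  exfalso
  obtain ⟨e, m, hm, rfl⟩ := Nat.exists_eq_pow_mul_and_not_dvd hi p (Fact.out : p.Prime).ne_one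
  have hm0 : m ≠ 0 := fun h => hm (h ▸ dvd_zero p)
  set d := p ^ e * m - p ^ e with hd
  have hdm : p ^ e + d = p ^ e * m := by
    have : p ^ e ≤ p ^ e * m := Nat.le_mul_of_pos_right _ (Nat.pos_of_ne_zero hm0)
    omega
  set b : ℕ → WithTop G := fun j =>
    (evalAt (QuasiFinite.hasseDeriv j F) (wSeries k hΓ ι)).orderTop with hb
  set g := QuasiFinite.hasseDeriv d F
  have hg := support_coeff_hasseDeriv_subset hF d
  -- The binomial factor equals `(p ^ e * m).choose (p ^ e)`, a nonzero constant of `k`, so it does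
  -- not change the value.
  have hcast : ((((p ^ e + d).choose d : ℕ) : HahnSeries G k)).orderTop = 0 := by
    refine orderTop_natCast fun h => ?_
    rw [CharP.cast_eq_zero_iff k p, Nat.choose_symm_add.symm, hdm] at h
    exact not_dvd_choose_pow_mul hm e h
  have hge : (evalAt (QuasiFinite.hasseDeriv (p ^ e) g) (wSeries k hΓ ι)).orderTop =
      b (p ^ e * m) := by
    rw [orderTop_evalAt_hasseDeriv_hasseDeriv hS hF hw0, hcast, zero_add, hdm]
  have hbne : evalAt (QuasiFinite.hasseDeriv (p ^ e * m) F) (wSeries k hΓ ι) ≠ 0 := by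
    -- An infinite value could not be strictly below that of another index; any other index serves.
    intro h
    have := hL L le_rfl (p ^ e * m + 1) trivial (by omega)
    simp [h] at this
  obtain ⟨N, hN⟩ := exists_orderTop_evalAt_lt hΓ hι hS hSq
    (support_coeff_hasseDeriv_subset hF (p ^ e * m)) hbne (p ^ e)
  have hval : ∀ l, L ≤ l → (evalAt g (wTrunc k hΓ ι l)).orderTop =
      b (p ^ e * m) + ((p ^ e • ι (betaSeq hΓ (l + 1)) : G) : WithTop G) := by
    intro l hl
    have hz : (-wTail k hΓ ι l).orderTop = ((ι (betaSeq hΓ (l + 1)) : G) : WithTop G) := by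
      rw [HahnSeries.orderTop_neg, orderTop_wTail]
    have hwl : wTrunc k hΓ ι l = wSeries k hΓ ι + -wTail k hΓ ι l := by
      rw [← wTrunc_add_wTail hΓ hι l, add_neg_cancel_right]
    rw [hwl, orderTop_evalAt_add_eq hS hS0 hg hw0 le_rfl (z := -wTail k hΓ ι l) (i := p ^ e)
      (N := N), hge, hz, WithTop.coe_nsmul]
    · rw [orderTop_wSeries, hz]
      exact WithTop.coe_le_coe.2 ((betaSeq_succ_strictMono hΓ hι).monotone (Nat.zero_le l))
    · rw [hge, hz, orderTop_wSeries, ← WithTop.coe_nsmul, ← WithTop.coe_nsmul]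
      refine lt_of_le_of_lt (add_le_add_right (WithTop.coe_le_coe.2 ?_) _) hN
      exact nsmul_le_nsmul_right (betaSeq_succ_le_one hΓ l) _
    · intro j hj
      -- Minimality of `p ^ e` for `g` is minimality of `p ^ e * m` for `F` with `d • β_{l+1}`
      -- cancelled; the binomial factors at other indices can only raise values.
      rw [hge, hz, orderTop_evalAt_hasseDeriv_hasseDeriv hS hF hw0]
      obtain ⟨c, hc⟩ := WithTop.ne_top_iff_exists.1 (HahnSeries.orderTop_ne_top.2 hbne)
      have h1 := hL l hl (j + d) trivial (by omega)
      have h2 : ((j + d) • ι (betaSeq hΓ (l + 1)) : G) = j • ι (betaSeq hΓ (l + 1)) +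
        d • ι (betaSeq hΓ (l + 1)) := add_nsmul _ _ _
      have h3 : ((p ^ e * m) • ι (betaSeq hΓ (l + 1)) : G) = p ^ e • ι (betaSeq hΓ (l + 1)) +
        d • ι (betaSeq hΓ (l + 1)) := by rw [← hdm, add_nsmul]
      rw [h2, h3, WithTop.coe_add, WithTop.coe_add, ← add_assoc, ← add_assoc,
        WithTop.add_lt_add_iff_right WithTop.coe_ne_top] at h1
      rw [← WithTop.coe_nsmul, ← WithTop.coe_nsmul]
      refine h1.trans_le (add_le_add_left ?_ _)
      exact le_add_of_nonneg_left (orderTop_natCast_nonneg _)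
  obtain ⟨r, hr⟩ := hSq
  obtain ⟨c, hc⟩ := WithTop.ne_top_iff_exists.1 (HahnSeries.orderTop_ne_top.2 hbne)
  have hmem : ∀ l, L ≤ l → r ≤ l → 1 ≤ l → c + p ^ e • ι (betaSeq hΓ (l + 1)) ∈
      (padicBall q Γ l).map (ι : Γ →+ G) := by
    intro l hl hrl hl1
    have h1 := hval l hl
    rw [hb] at h1
    simp only [← hc, ← WithTop.coe_add] at h1
    have hpos : 0 < (wTrunc k hΓ ι l).orderTop := by
      have hwl : wTrunc k hΓ ι l = wSeries k hΓ ι + -wTail k hΓ ι l := by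
        rw [← wTrunc_add_wTail hΓ hι l, add_neg_cancel_right]
      rw [hwl]
      refine lt_of_lt_of_le (lt_min hw0 ?_) HahnSeries.min_orderTop_le_orderTop_add
      rw [HahnSeries.orderTop_neg, orderTop_wTail]
      exact WithTop.coe_lt_coe.2 ((betaSeq_one_pos hΓ hι).trans_le
        ((betaSeq_succ_strictMono hΓ hι).monotone (Nat.zero_le l)))
    refine support_evalAt_subset hS hg (hr.trans ?_) hpos (support_wTrunc_subset hΓ l)
      (HahnSeries.coeff_orderTop_ne h1)
    exact AddSubgroup.map_mono (padicBall_mono hrl)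
  set l := L + r + 1 with hl
  have h1 := AddSubgroup.map_mono (f := (ι : Γ →+ G)) (padicBall_mono (q := q) (Nat.le_succ l))
    (hmem l (by omega) (by omega) (by omega))
  have h2 := hmem (l + 1) (by omega) (by omega) (by omega)
  -- Subtracting consecutive memberships eliminates the unknown value `c`.
  have h3 := AddSubgroup.sub_mem _ h2 h1
  rw [add_sub_add_left_eq_sub, ← map_nsmul, ← map_nsmul, ← map_sub] at h3
  obtain ⟨a, ha, hae⟩ := h3
  have ha' : a = p ^ e • betaSeq hΓ (l + 1 + 1) - p ^ e • betaSeq hΓ (l + 1) := hι hae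
  rw [ha'] at ha
  have h4 := AddSubgroup.add_mem _ ha
    (AddSubgroup.nsmul_mem _ (betaSeq_mem_padicBall hΓ (l + 1)) (p ^ e))
  rw [sub_add_cancel] at h4
  refine nsmul_betaSeq_sub_notMem_padicBall hΓ (l + 1) (fun h => hpq ?_) h4
  exact (((Nat.prime_dvd_prime_iff_eq Fact.out Fact.out).1
    ((Fact.out : q.Prime).dvd_of_dvd_pow h))).symm

theorem evalAt_wSeries_ne_zero {F : PowerSeries (HahnSeries G k)}
    (hF : ∀ j, (PowerSeries.coeff j F).support ⊆ S) (hF0 : F ≠ 0) :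
    evalAt F (wSeries k hΓ ι) ≠ 0 := by
  obtain ⟨L, hL⟩ := eventually_orderTop_evalAt_lt hΓ hι hS hS0 hSq hpq hF hF0
  exact HahnSeries.orderTop_ne_top.1 (ne_top_of_lt (hL L le_rfl 1 one_ne_zero))

theorem eventually_orderTop_evalAt_add_eq {F : PowerSeries (HahnSeries G k)}
    (hF : ∀ j, (PowerSeries.coeff j F).support ⊆ S) (hF0 : F ≠ 0) :
    ∃ L, ∀ l, L ≤ l → ∀ z : HahnSeries G k,
      ((ι (betaSeq hΓ (l + 1)) : G) : WithTop G) ≤ z.orderTop →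
      (evalAt F (wSeries k hΓ ι + z)).orderTop = (evalAt F (wSeries k hΓ ι)).orderTop := by
  obtain ⟨L, hL⟩ := eventually_orderTop_evalAt_lt hΓ hι hS hS0 hSq hpq hF hF0
  have hne := evalAt_wSeries_ne_zero hΓ hι hS hS0 hSq hpq hF hF0
  obtain ⟨N, hN⟩ := exists_orderTop_evalAt_lt hΓ hι hS hSq hF hne 0
  rw [zero_nsmul, WithTop.coe_zero, add_zero] at hN
  refine ⟨L, fun l hl z hz => ?_⟩
  rw [orderTop_evalAt_add_eq hS hS0 hF (orderTop_wSeries_pos (k := k) hΓ hι) le_rfl (z := z)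
    (i := 0) (N := N), hasseDeriv_zero_index, zero_nsmul, add_zero]
  · rw [orderTop_wSeries]
    refine le_trans ?_ hz
    exact WithTop.coe_le_coe.2 ((betaSeq_succ_strictMono hΓ hι).monotone (Nat.zero_le l))
  · rw [hasseDeriv_zero_index, zero_nsmul, add_zero, orderTop_wSeries, ← WithTop.coe_nsmul]
    exact hN
  · intro j hj
    rw [hasseDeriv_zero_index, zero_nsmul, add_zero]
    refine (hL l hl j hj).trans_le (add_le_add_right ?_ _)
    rw [WithTop.coe_nsmul]
    exact nsmul_le_nsmul_right hz j

/-- For a minimizer `p ^ e * m` with `m ≠ 1`, the value of the `p ^ e`-th derivative at `w` lies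
below its own first-order competitors, among them the one of order `d = p ^ e * m - p ^ e`. Adding
`p ^ e • β_{l+1}` contradicts minimality. -/
theorem exists_pow_eventually_unique_minimizer {F : PowerSeries (HahnSeries G k)}
    (hF : ∀ j, (PowerSeries.coeff j F).support ⊆ S)
    (hF1 : ∃ i, 0 < i ∧ PowerSeries.coeff i F ≠ 0) :
    ∃ e L, ∀ l, L ≤ l → ∀ j, 0 < j → j ≠ p ^ e →
      (evalAt (QuasiFinite.hasseDeriv (p ^ e) F) (wSeries k hΓ ι)).orderTop +
          ((p ^ e • ι (betaSeq hΓ (l + 1)) : G) : WithTop G) <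
        (evalAt (QuasiFinite.hasseDeriv j F) (wSeries k hΓ ι)).orderTop +
          ((j • ι (betaSeq hΓ (l + 1)) : G) : WithTop G) := by
  have hw0 := orderTop_wSeries_pos (k := k) hΓ hι
  obtain ⟨i₀, hi₀, hc⟩ := hF1
  have hD0 : QuasiFinite.hasseDeriv i₀ F ≠ 0 := by
    intro h
    have h1 := congrArg (PowerSeries.coeff 0) h
    simp [QuasiFinite.hasseDeriv] at h1
    exact hc h1
  obtain ⟨i, hi, L, hL⟩ := exists_eventually_unique_minimizer_evalAt hΓ hι hS hS0 hSq hF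
    (I := {i | 0 < i}) ⟨i₀, hi₀, evalAt_wSeries_ne_zero hΓ hι hS hS0 hSq hpq
      (support_coeff_hasseDeriv_subset hF i₀) hD0⟩
  obtain ⟨e, m, hm, rfl⟩ := Nat.exists_eq_pow_mul_and_not_dvd (Nat.pos_iff_ne_zero.1 hi) p
    (Fact.out : p.Prime).ne_one
  have hpe : 0 < p ^ e := pow_pos (Fact.out : p.Prime).pos e
  rcases eq_or_ne m 1 with rfl | hm1
  · rw [mul_one] at hL
    exact ⟨e, L, hL⟩
  exfalso
  have hm0 : m ≠ 0 := fun h => hm (h ▸ dvd_zero p)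
  have hlt : p ^ e < p ^ e * m := lt_mul_of_one_lt_right hpe (by omega)
  set d := p ^ e * m - p ^ e with hd
  have hdm : d + p ^ e = p ^ e * m := by omega
  have hbne : evalAt (QuasiFinite.hasseDeriv (p ^ e * m) F) (wSeries k hΓ ι) ≠ 0 := by
    intro h
    have := hL L le_rfl (p ^ e * m + 1) (Nat.succ_pos _) (by omega)
    simp [h] at this
  have hcast : ((((d + p ^ e).choose (p ^ e) : ℕ) : HahnSeries G k)).orderTop = 0 := by
    refine orderTop_natCast fun h => ?_
    rw [CharP.cast_eq_zero_iff k p, hdm] at h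
    exact not_dvd_choose_pow_mul hm e h
  have hDD := orderTop_evalAt_hasseDeriv_hasseDeriv hS hF hw0 d (p ^ e)
  rw [hcast, zero_add, hdm] at hDD
  have hDe : QuasiFinite.hasseDeriv (p ^ e) F ≠ 0 := by
    intro h
    have h0 : QuasiFinite.hasseDeriv d (0 : PowerSeries (HahnSeries G k)) = 0 := by
      ext j
      simp [QuasiFinite.hasseDeriv]
    rw [h, h0, evalAt_zero_left, HahnSeries.orderTop_zero] at hDD
    exact HahnSeries.orderTop_ne_top.2 hbne hDD.symm
  obtain ⟨L', hL'⟩ := eventually_orderTop_evalAt_lt hΓ hι hS hS0 hSq hpq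
    (support_coeff_hasseDeriv_subset hF (p ^ e)) hDe
  have h1 := hL' (max L L') (le_max_right _ _) d (by omega)
  have h2 := hL (max L L') (le_max_left _ _) (p ^ e) hpe hlt.ne
  rw [hDD] at h1
  have h3 : ∀ g : G, (p ^ e * m) • g = d • g + p ^ e • g := fun g => by rw [← hdm, add_nsmul]
  rw [h3, WithTop.coe_add, ← add_assoc, WithTop.add_lt_add_iff_right WithTop.coe_ne_top] at h2
  exact absurd h1 (not_lt.2 h2.le)

end Values

/-! ### Henselization inside a ring of power series -/

section Henselization

theorem powerSeries_henselianLocalRing (k : Type*) [Field k] :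
    HenselianLocalRing (PowerSeries k) where
  is_henselian f hf a₀ h₁ h₂ := by
    rw [PowerSeries.maximalIdeal_eq_span_X] at h₁ ⊢
    exact HenselianRing.is_henselian f hf a₀ h₁ (h₂.map _)

theorem henselianLocalRing_of_ringEquiv {A B : Type*} [CommRing A] [CommRing B] (e : A ≃+* B)
    [HenselianLocalRing A] : HenselianLocalRing B where
  toIsLocalRing := e.isLocalRing
  is_henselian f hf a₀ h₁ h₂ := by
    have hB : IsLocalRing B := e.isLocalRing
    have hmem : ∀ b : B, e.symm b ∈ IsLocalRing.maximalIdeal A ↔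
        b ∈ IsLocalRing.maximalIdeal B := fun b => by
      rw [IsLocalRing.mem_maximalIdeal, IsLocalRing.mem_maximalIdeal, mem_nonunits_iff,
        mem_nonunits_iff, MulEquiv.isUnit_map]
    obtain ⟨a, ha, hab⟩ := HenselianLocalRing.is_henselian (f.map (e.symm : B →+* A))
      (hf.map _) (e.symm a₀)
      (by
        rw [← RingEquiv.coe_toRingHom, Polynomial.eval_map_apply, RingEquiv.coe_toRingHom]
        exact (hmem _).2 h₁)
      (by
        rw [Polynomial.derivative_map, ← RingEquiv.coe_toRingHom, Polynomial.eval_map_apply]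
        exact h₂.map _)
    refine ⟨e a, ?_, ?_⟩
    · rw [Polynomial.IsRoot.def] at ha ⊢
      apply e.symm.injective
      rw [map_zero, ← ha, ← RingEquiv.coe_toRingHom, ← Polynomial.eval_map_apply,
        RingEquiv.coe_toRingHom, e.symm_apply_apply]
    · rw [← hmem, map_sub, e.symm_apply_apply]
      exact hab

variable {k G : Type*} [Field k] [AddCommGroup G] [LinearOrder G] [IsOrderedAddMonoid G]

/-! ### The henselian subring `k[[t^d]]` -/

theorem nsmul_injective_of_pos {d : G} (hd : 0 < d) : Function.Injective (multiplesHom G d) :=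
  (show StrictMono fun n : ℕ => n • d from fun _ _ h => nsmul_lt_nsmul_left hd h).injective

theorem nsmul_le_iff_of_pos {d : G} (hd : 0 < d) (m n : ℕ) :
    multiplesHom G d m ≤ multiplesHom G d n ↔ m ≤ n :=
  (show StrictMono fun n : ℕ => n • d from fun _ _ h => nsmul_lt_nsmul_left hd h).le_iff_le

/-- The substitution `X ↦ t^d`, from `k[[X]]` to the valuation ring of `k((t^G))`. -/
noncomputable def powerSeriesToHahn (k : Type*) [Field k] {d : G} (hd : 0 < d) :
    PowerSeries k →+* hahnValuationRing k G :=
  ((HahnSeries.embDomainRingHom (multiplesHom G d) (nsmul_injective_of_pos hd)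
    (nsmul_le_iff_of_pos hd)).comp
      (HahnSeries.toPowerSeries (R := k)).symm.toRingHom).codRestrict (hahnValuationRing k G)
    fun f => by
      refine HahnSeries.le_orderTop_iff_forall.2 fun g hg => ?_
      refine HahnSeries.embDomain_of_notMem_range ?_
      rintro ⟨m, rfl⟩
      exact absurd hg (not_lt.2 (WithTop.coe_le_coe.2 (nsmul_nonneg hd.le m)))

theorem coeff_powerSeriesToHahn {d : G} (hd : 0 < d) (f : PowerSeries k) (m : ℕ) :
    (powerSeriesToHahn k hd f : HahnSeries G k).coeff (m • d) = PowerSeries.coeff m f := by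
  have h := HahnSeries.embDomain_coeff (f := ⟨⟨multiplesHom G d, nsmul_injective_of_pos hd⟩,
    nsmul_le_iff_of_pos hd _ _⟩) (x := (HahnSeries.toPowerSeries (R := k)).symm f) (a := m)
  rw [HahnSeries.coeff_toPowerSeries_symm] at h
  exact h

theorem support_powerSeriesToHahn_subset {d : G} (hd : 0 < d) (f : PowerSeries k) :
    (powerSeriesToHahn k hd f : HahnSeries G k).support ⊆ Set.range fun m : ℕ => m • d := by
  intro g hg
  by_contra h
  exact hg (HahnSeries.embDomain_of_notMem_range h)

theorem mem_range_powerSeriesToHahn {d : G} (hd : 0 < d) {x : hahnValuationRing k G}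
    (hx : (x : HahnSeries G k).support ⊆ Set.range fun m : ℕ => m • d) :
    x ∈ (powerSeriesToHahn k hd).range := by
  refine ⟨PowerSeries.mk fun m => (x : HahnSeries G k).coeff (m • d), ?_⟩
  ext g
  by_cases hg : g ∈ Set.range fun m : ℕ => m • d
  · obtain ⟨m, rfl⟩ := hg
    change HahnSeries.coeff _ (m • d) = _
    rw [coeff_powerSeriesToHahn, PowerSeries.coeff_mk]
  · have h1 : (powerSeriesToHahn k hd
        (PowerSeries.mk fun m => (x : HahnSeries G k).coeff (m • d)) : HahnSeries G k).coeff g =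
          0 := by
      by_contra h
      exact hg (support_powerSeriesToHahn_subset hd _ h)
    have h2 : (x : HahnSeries G k).coeff g = 0 := by
      by_contra h
      exact hg (hx h)
    exact h1.trans h2.symm

theorem powerSeriesToHahn_injective {d : G} (hd : 0 < d) :
    Function.Injective (powerSeriesToHahn k hd) := by
  intro f f' h
  ext m
  rw [← coeff_powerSeriesToHahn hd, h, coeff_powerSeriesToHahn]

theorem henselianLocalRing_range_powerSeriesToHahn {d : G} (hd : 0 < d) :
    HenselianLocalRing (powerSeriesToHahn k hd).range :=
  have := powerSeries_henselianLocalRing k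
  henselianLocalRing_of_ringEquiv (RingEquiv.ofBijective (powerSeriesToHahn k hd).rangeRestrict
    ⟨fun _ _ h => powerSeriesToHahn_injective hd (congrArg Subtype.val h),
      (powerSeriesToHahn k hd).rangeRestrict_surjective⟩)

/-- A unit of the valuation ring has order `0`, so the power series it comes from has nonzero
constant coefficient. -/
theorem isLocalHom_range_powerSeriesToHahn {d : G} (hd : 0 < d) :
    IsLocalHom (powerSeriesToHahn k hd).range.subtype where
  map_nonunit := by
    rintro ⟨_, f, rfl⟩ h
    obtain ⟨b, hb⟩ := h.exists_right_inv
    have hb' : (powerSeriesToHahn k hd f : HahnSeries G k) * (b : HahnSeries G k) = 1 :=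
      congrArg Subtype.val hb
    have h1 := congrArg HahnSeries.orderTop hb'
    rw [HahnSeries.orderTop_mul, HahnSeries.orderTop_one] at h1
    have ha : 0 ≤ (powerSeriesToHahn k hd f : HahnSeries G k).orderTop :=
      (powerSeriesToHahn k hd f).2
    have h2 : (powerSeriesToHahn k hd f : HahnSeries G k).orderTop = ((0 : G) : WithTop G) :=
      le_antisymm (le_of_le_of_eq (le_add_of_nonneg_right b.2) h1) ha
    have h3 := HahnSeries.coeff_orderTop_ne h2
    rw [← zero_nsmul d, coeff_powerSeriesToHahn, PowerSeries.coeff_zero_eq_constantCoeff] at h3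
    have hu : IsUnit f := PowerSeries.isUnit_iff_constantCoeff.2 (isUnit_iff_ne_zero.2 h3)
    exact hu.map (powerSeriesToHahn k hd).rangeRestrict

/-- The field `k(t^{g_1}, …, t^{g_n})` lies in the image of `k((X))` under `X ↦ t^d`, and
nonnegative order leaves only exponents `m • d` with `m ≥ 0`. -/
theorem baseRing_le_range_powerSeriesToHahn {d : G} (hd : 0 < d) {n : ℕ} {g : Fin n → G}
    (hg : ∀ j, ∃ m : ℕ, g j = m • d) : baseRing k g ≤ (powerSeriesToHahn k hd).range := by
  have hmono : StrictMono fun n : ℤ => n • d := fun _ _ h => zsmul_lt_zsmul_left hd h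
  let φ : HahnSeries ℤ k →+* HahnSeries G k :=
    HahnSeries.embDomainRingHom (zmultiplesHom G d) hmono.injective fun _ _ => hmono.le_iff_le
  have hφs : ∀ z : HahnSeries ℤ k, (φ z).support ⊆ Set.range fun m : ℤ => m • d := by
    intro z g hg
    by_contra h
    exact hg (HahnSeries.embDomain_of_notMem_range h)
  have hle : IntermediateField.adjoin k
      (Set.range fun j => (HahnSeries.single (g j) 1 : HahnSeries G k)) ≤
        φ.fieldRange.toIntermediateField fun r =>
          ⟨HahnSeries.C r, HahnSeries.embDomainRingHom_C⟩ := by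
    rw [IntermediateField.adjoin_le_iff]
    rintro _ ⟨j, rfl⟩
    obtain ⟨m, hm⟩ := hg j
    refine ⟨HahnSeries.single (m : ℤ) 1, ?_⟩
    refine (HahnSeries.embDomain_single).trans ?_
    change HahnSeries.single ((m : ℤ) • d) 1 = HahnSeries.single (g j) (1 : k)
    rw [natCast_zsmul, hm]
  intro x hx
  obtain ⟨z, hz⟩ := hle hx
  refine mem_range_powerSeriesToHahn hd fun h hh => ?_
  have hxz : φ z = (x : HahnSeries G k) := hz
  obtain ⟨m, rfl⟩ := hφs z (hxz ▸ hh)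
  have h0 : (0 : WithTop G) ≤ (x : HahnSeries G k).orderTop := x.2
  have h1 := h0.trans (HahnSeries.orderTop_le_of_coeff_ne_zero hh)
  rw [← WithTop.coe_zero, WithTop.coe_le_coe, ← zero_zsmul d] at h1
  obtain ⟨m', rfl⟩ := Int.eq_ofNat_of_zero_le (hmono.le_iff_le.1 h1)
  exact ⟨m', (natCast_zsmul d m').symm⟩

theorem henselBase_le_range_powerSeriesToHahn {d : G} (hd : 0 < d) {n : ℕ} {g : Fin n → G}
    (hg : ∀ j, ∃ m : ℕ, g j = m • d) : henselBase k g ≤ (powerSeriesToHahn k hd).range :=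
  sInf_le ⟨baseRing_le_range_powerSeriesToHahn hd hg,
    henselianLocalRing_range_powerSeriesToHahn hd, isLocalHom_range_powerSeriesToHahn hd⟩

/-- With `D` a common denominator, `1 / D` need not lie in `Γ`. The integers `z` with `z / D ∈ Γ`
form a subgroup `aℤ`, nonzero because `1 ∈ Γ`, and `δ = |a| / D` works. -/
theorem exists_common_generator {Γ : AddSubgroup ℚ} (h1 : (1 : ℚ) ∈ Γ) {n : ℕ} (γ : Fin n → Γ)
    (hγ : ∀ j, 0 < γ j) : ∃ δ : Γ, 0 < δ ∧ ∀ j, ∃ m : ℕ, γ j = m • δ := by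
  set D : ℕ := ∏ j, (γ j : ℚ).den with hD
  have hD0 : (0 : ℚ) < D := by
    exact_mod_cast prod_pos fun j _ => (γ j : ℚ).den_pos
  set ψ : ℤ →+ ℚ := (AddMonoidHom.mulRight (1 / (D : ℚ))).comp (Int.castAddHom ℚ) with hψ
  have hψa : ∀ z : ℤ, ψ z = z * (1 / (D : ℚ)) := fun z => rfl
  obtain ⟨a, ha⟩ := Int.subgroup_cyclic (Γ.comap ψ)
  have hmem : ∀ z : ℤ, ψ z ∈ Γ ↔ a ∣ z := fun z => by
    rw [← AddSubgroup.mem_comap, ha, ← AddSubgroup.zmultiples_eq_closure, Int.mem_zmultiples_iff]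
  have ha0 : a ≠ 0 := by
    rintro rfl
    have h := (hmem D).1 (by rw [hψa]; simpa [hD0.ne'] using h1)
    rw [zero_dvd_iff] at h
    exact hD0.ne' (by exact_mod_cast h)
  have hδ0 : 0 < ψ |a| := by
    rw [hψa]
    have : (0 : ℚ) < ((|a| : ℤ) : ℚ) := by exact_mod_cast abs_pos.2 ha0
    positivity
  refine ⟨⟨ψ |a|, (hmem _).2 ((dvd_abs a a).2 dvd_rfl)⟩, hδ0, fun j => ?_⟩
  obtain ⟨z, hz⟩ : ∃ z : ℤ, (γ j : ℚ) = ψ z := by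
    obtain ⟨c, hc⟩ := dvd_prod_of_mem (fun j => (γ j : ℚ).den) (mem_univ j)
    refine ⟨(γ j : ℚ).num * c, ?_⟩
    have hDc : (D : ℚ) = (γ j : ℚ).den * c := by exact_mod_cast hc
    rw [hψa, mul_one_div, eq_div_iff hD0.ne', hDc, ← mul_assoc, Rat.mul_den_eq_num]
    push_cast
    rfl
  have hzΓ : |a| ∣ z := (abs_dvd a z).2 ((hmem z).1 (hz ▸ (γ j).2))
  obtain ⟨c, rfl⟩ := hzΓ
  have hcz : (γ j : ℚ) = c * ψ |a| := by
    rw [hz, hψa, hψa]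
    push_cast
    ring
  have hc : 0 ≤ c := by
    have h : (0 : ℚ) < c * ψ |a| := hcz ▸ (show (0 : ℚ) < γ j from hγ j)
    exact_mod_cast ((pos_iff_pos_of_mul_pos h).2 hδ0).le
  obtain ⟨m, rfl⟩ := Int.eq_ofNat_of_zero_le hc
  refine ⟨m, Subtype.ext ?_⟩
  rw [hcz]
  simp

end Henselization

theorem support_henselBaseEmb_subset {k G : Type*} [Field k] [AddCommGroup G] [LinearOrder G]
    [IsOrderedAddMonoid G] {d : G} (hd : 0 < d) {n : ℕ} {g : Fin n → G}
    (hg : ∀ j, ∃ m : ℕ, g j = m • d) (a : henselBase k g) :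
    (henselBaseEmb g a).support ⊆ Set.range fun m : ℕ => m • d := by
  obtain ⟨f, hf⟩ := henselBase_le_range_powerSeriesToHahn hd hg a.2
  have h := support_powerSeriesToHahn_subset hd f
  rw [hf] at h
  exact h

theorem henselBaseEmb_injective {k G : Type*} [Field k] [AddCommGroup G] [LinearOrder G]
    [IsOrderedAddMonoid G] {n : ℕ} (g : Fin n → G) :
    Function.Injective (henselBaseEmb (k := k) g) :=
  fun _ _ h => Subtype.ext (Subtype.ext h)

end

/-! ### Assembly of the theorem -/

open QuasiFinite in
theorem mainTheorem5 {p q : ℕ} [Fact p.Prime] [Fact q.Prime] (hpq : p ≠ q)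
    {k : Type*} [Field k] [CharP k p]
    (Γ : AddSubgroup ℚ) (hΓ : ∀ i : ℕ, 1 / (q : ℚ) ^ i ∈ Γ)
    (n : ℕ) (γ : Fin n → Γ) (hγ : ∀ j, 0 < γ j)
    {G : Type*} [AddCommGroup G] [LinearOrder G] [IsOrderedAddMonoid G]
    (ι : Γ →+o G) (hι : Function.Injective ι)
    (β : G) (hβ : ι ⟨1, by simpa using hΓ 0⟩ ≤ β) (c : k)
    (f : PowerSeries (henselBase k fun j => ι (γ j)))
    (hf : f ∈ henselPowerSeries (henselBase k fun j => ι (γ j))) (hf0 : f ≠ 0) :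
    let w : HahnSeries G k := wSeries k hΓ ι
    let x : HahnSeries G k := w + HahnSeries.single β c
    let D : ℕ → PowerSeries (HahnSeries G k) := fun i =>
      (hasseDeriv i f).map (henselBaseEmb fun j => ι (γ j))
    let F : PowerSeries (HahnSeries G k) := f.map (henselBaseEmb fun j => ι (γ j))
    (∀ y : HahnSeries G k, 0 < y.orderTop → Evaluable F y ∧ ∀ i, Evaluable (D i) y) ∧
    ∃ l₀ : ℕ, 0 < l₀ ∧ ∃ e : ℕ, ∀ l : ℕ, l₀ ≤ l →
      ((evalAt F x).orderTop = (evalAt F (wTrunc k hΓ ι l)).orderTop ∧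
        (evalAt F (wTrunc k hΓ ι l)).orderTop ≠ ⊤) ∧
      (∃ m : WithTop G,
        IsLeast {a | ∃ i : ℕ, 0 < i ∧
          a = (evalAt (D i) w).orderTop + i • (wTail k hΓ ι l).orderTop} m ∧
        IsLeast {a | ∃ i : ℕ, 0 < i ∧
          a = (evalAt (D i) w).orderTop + ((i • ι (betaSeq hΓ (l + 1)) : G) : WithTop G)} m ∧
        (evalAt F (wTrunc k hΓ ι l)).orderTop < m) ∧
      ((∀ a : henselBase k fun j => ι (γ j), f ≠ PowerSeries.C a) →
        ∀ y ∈ ({w, x} : Set (HahnSeries G k)), ∀ i : ℕ, 0 < i → i ≠ p ^ e →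
          (evalAt (D (p ^ e)) y).orderTop +
              ((p ^ e • ι (betaSeq hΓ (l + 1)) : G) : WithTop G) <
            (evalAt (D i) y).orderTop + ((i • ι (betaSeq hΓ (l + 1)) : G) : WithTop G)) := by
  intro w x D F
  obtain ⟨δ, hδ0, hδ⟩ := exists_common_generator (by simpa using hΓ 0) γ hγ
  have hιδ : 0 < ι δ := by
    rw [← map_zero ι]
    exact orderHom_strictMono hι hδ0
  have hγδ : ∀ j, ∃ m : ℕ, ι (γ j) = m • ι δ := fun j => by
    obtain ⟨m, hm⟩ := hδ j
    exact ⟨m, by rw [hm, map_nsmul]⟩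
  set S : Set G := Set.range fun m : ℕ => m • ι δ with hSdef
  have hS : S.IsPWO := by
    rw [hSdef, ← Set.image_univ]
    exact (Set.IsPWO.of_linearOrder (Set.univ : Set ℕ)).image_of_monotone
      fun _ _ h => nsmul_le_nsmul_left hιδ.le h
  have hS0 : ∀ g ∈ S, 0 ≤ g := by
    rintro _ ⟨m, rfl⟩
    exact nsmul_nonneg hιδ.le m
  have hSq : ∃ r, S ⊆ (padicBall q Γ r).map (ι : Γ →+ G) := by
    obtain ⟨r, hr⟩ := exists_mem_padicBall (q := q) δ
    refine ⟨r, ?_⟩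
    rintro _ ⟨m, rfl⟩
    exact ⟨m • δ, AddSubgroup.nsmul_mem _ hr m, map_nsmul ι m δ⟩
  have hF : ∀ j, (PowerSeries.coeff j F).support ⊆ S := fun j => by
    rw [PowerSeries.coeff_map]
    exact support_henselBaseEmb_subset hιδ hγδ _
  have hcoeff : ∀ j, PowerSeries.coeff j F = 0 → PowerSeries.coeff j f = 0 := fun j h => by
    rw [PowerSeries.coeff_map] at h
    exact henselBaseEmb_injective _ (h.trans (map_zero _).symm)
  have hF0 : F ≠ 0 := fun h => hf0 <| PowerSeries.ext fun j => by
    rw [hcoeff j (by rw [h, map_zero]), map_zero]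
  have hD : ∀ i, D i = QuasiFinite.hasseDeriv i F := fun i => hasseDeriv_map _ i f
  have hDF := fun i => support_coeff_hasseDeriv_subset hF i
  refine ⟨fun y hy => ⟨evaluable_of_support_subset hS hF hy, fun i => ?_⟩, ?_⟩
  · rw [hD]
    exact evaluable_of_support_subset hS (hDF i) hy
  have hz : ∀ l, ((ι (betaSeq hΓ (l + 1)) : G) : WithTop G) ≤
      (HahnSeries.single β c).orderTop := fun l =>
    (WithTop.coe_le_coe.2 ((betaSeq_succ_le_one hΓ l).trans hβ)).trans
      HahnSeries.orderTop_single_le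
  -- The threshold depends on `i`, but this perturbation has order at least `β_{l+1}` for every `l`,
  -- so equality holds for all `i` at once.
  have hx : ∀ i, (evalAt (D i) x).orderTop = (evalAt (D i) w).orderTop := by
    intro i
    rw [hD]
    by_cases h : QuasiFinite.hasseDeriv i F = 0
    · rw [h, evalAt_zero_left, evalAt_zero_left]
    · obtain ⟨L, hL⟩ := eventually_orderTop_evalAt_add_eq hΓ hι hS hS0 hSq hpq (hDF i) h
      exact hL L le_rfl _ (hz L)
  obtain ⟨L₁, hL₁⟩ := eventually_orderTop_evalAt_lt hΓ hι hS hS0 hSq hpq hF hF0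
  obtain ⟨L₂, hL₂⟩ := eventually_orderTop_evalAt_add_eq hΓ hι hS hS0 hSq hpq hF hF0
  have hval : ∀ l, L₂ ≤ l → (evalAt F (wTrunc k hΓ ι l)).orderTop = (evalAt F w).orderTop := by
    intro l hl
    rw [← hL₂ l hl (-wTail k hΓ ι l) (by rw [HahnSeries.orderTop_neg, orderTop_wTail]),
      ← wTrunc_add_wTail hΓ hι l, add_neg_cancel_right]
  have hFx : (evalAt F x).orderTop = (evalAt F w).orderTop := hL₂ L₂ le_rfl _ (hz L₂)
  have hFw : (evalAt F w).orderTop ≠ ⊤ :=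
    HahnSeries.orderTop_ne_top.2 (evalAt_wSeries_ne_zero hΓ hι hS hS0 hSq hpq hF hF0)
  have htail : ∀ l i, (evalAt (D i) w).orderTop + i • (wTail k hΓ ι l).orderTop =
      (evalAt (D i) w).orderTop + ((i • ι (betaSeq hΓ (l + 1)) : G) : WithTop G) := fun l i => by
    rw [orderTop_wTail, WithTop.coe_nsmul]
  simp only [htail, and_self_left]
  have key : ∃ e L, ∀ l, L ≤ l →
      (∃ m, 0 < m ∧ ∀ j, 0 < j →
        (evalAt (D m) w).orderTop + ((m • ι (betaSeq hΓ (l + 1)) : G) : WithTop G) ≤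
          (evalAt (D j) w).orderTop + ((j • ι (betaSeq hΓ (l + 1)) : G) : WithTop G)) ∧
      ((∀ a : henselBase k fun j => ι (γ j), f ≠ PowerSeries.C a) → ∀ j, 0 < j → j ≠ p ^ e →
        (evalAt (D (p ^ e)) w).orderTop +
            ((p ^ e • ι (betaSeq hΓ (l + 1)) : G) : WithTop G) <
          (evalAt (D j) w).orderTop + ((j • ι (betaSeq hΓ (l + 1)) : G) : WithTop G)) := by
    by_cases hF1 : ∃ i, 0 < i ∧ PowerSeries.coeff i F ≠ 0
    · obtain ⟨e, L, hL⟩ :=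
        exists_pow_eventually_unique_minimizer hΓ hι hS hS0 hSq hpq hF hF1
      simp only [← hD] at hL
      refine ⟨e, L, fun l hl => ⟨⟨p ^ e, pow_pos (Fact.out : p.Prime).pos e, fun j hj => ?_⟩,
        fun _ => hL l hl⟩⟩
      rcases eq_or_ne j (p ^ e) with rfl | h
      · exact le_rfl
      · exact (hL l hl j hj h).le
    · push Not at hF1
      have hD0 : ∀ j, 0 < j → D j = 0 := fun j hj => by
        rw [hD]
        ext m : 1
        rw [QuasiFinite.hasseDeriv, PowerSeries.coeff_mk, hF1 (m + j) (by omega), mul_zero,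
          map_zero]
      -- For constant `f` all higher derivatives vanish: the minimum is `⊤`, attained for instance
      -- at `1`, and `e` is arbitrary.
      refine ⟨0, 0, fun l _ => ⟨⟨1, one_pos, fun j hj => ?_⟩, fun hconst => ?_⟩⟩
      · rw [hD0 j hj, evalAt_zero_left, HahnSeries.orderTop_zero, top_add]
        exact le_top
      · refine absurd (PowerSeries.ext fun j => ?_) (hconst (PowerSeries.coeff 0 f))
        rw [PowerSeries.coeff_C]
        split_ifs with hj
        · rw [hj]
        · exact hcoeff j (hF1 j (Nat.pos_of_ne_zero hj))
  obtain ⟨e, L₃, hL₃⟩ := key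
  refine ⟨L₁ + L₂ + L₃ + 1, Nat.succ_pos _, e, fun l hl => ⟨⟨?_, ?_⟩, ?_, ?_⟩⟩
  · rw [hFx, hval l (by omega)]
  · rwa [hval l (by omega)]
  · obtain ⟨m, hm0, hm⟩ := (hL₃ l (by omega)).1
    refine ⟨_, ⟨⟨m, hm0, rfl⟩, ?_⟩, ?_⟩
    · rintro _ ⟨j, hj, rfl⟩
      exact hm j hj
    · rw [hval l (by omega), hD]
      exact hL₁ l (by omega) m hm0.ne'
  · intro hconst y hy i hi hie
    have h := (hL₃ l (by omega)).2 hconst i hi hie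
    rcases hy with rfl | rfl
    · exact h
    · rw [hx, hx]
      exact h
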